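/- Let $k$ be an algebraically closed field of characteristic zero, $N\ge 2$ an integer and $q\in k$ a primitive $N$-th root of unity. Let $a_1,a_2,b_1,b_2\in\mathbb Z_N=\mathbb Z/N\mathbb Z$ satisfy $$a_1b_1\neq 0,\qquad a_2b_2\neq 0,\qquad a_1b_2+a_2b_1=0,$$ and let $N_x$, $N_y$ be the orders of $a_1b_1$ and $a_2b_2$ in the additive group $\mathbb Z_N$. The generalised Taft algebra $H=H_q(a_1,a_2,b_1,b_2)$ is the Hopf algebra over $k$ generated by $g,x,y$ with relations $$g^N=1,\quad x^{N_x}=0,\quad y^{N_y}=0,\quad gx=q^{b_1}xg,\quad gy=q^{b_2}yg,\quad xy=q^{a_1b_2}yx,$$ comultiplication $\Delta(g)=g\otimes g$, $\Delta(x)=1\otimes x+x\otimes g^{a_1}$, $\Delta(y)=1\otimes y+y\otimes g^{a_2}$, counit $\varepsilon(g)=1$, $\varepsilon(x)=\varepsilon(y)=0$, and antipode $S(g)=g^{-1}$, $S(x)=-xg^{-a_1}$, $S(y)=-yg^{-a_2}$. A pair in involution for $H$ is a pair $(l,\beta)$ of a group-like element $l\in H$ and a character (algebra homomorphism) $\beta:H\to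 k$, with convolution inverse $\beta^{-1}=\beta\circ S$, such that $$S^2(h)=\beta(h_{(3)})\,\beta^{-1}(h_{(1)})\;l\,h_{(2)}\,l^{-1}\qquad\text{for all }h\in H;$$ it is modular if moreover $\beta(l)=1$. Let $\xi:H\to k$ be the character with $\xi(g)=q^{-1}$, $\xi(x)=\xi(y)=0$. Theorem. $H$ has a pair in involution if and only if there are $c,d\in\mathbb Z_N$ with $$a_1c+b_1d=a_1b_1,\qquad a_2c+b_2d=a_2b_2\qquad\text{in }\mathbb Z_N, \tag{1}$$ and $H$ has a modular pair in involution if and only if there are $c,d\in\mathbb Z_N$ that satisfy (1) and $cd=0$ in $\mathbb Z_N$. More precisely, every pair $(l,\beta)$ of a group-like element and a character of $H$ can be written as $(g^d,\xi^{-c})$ for exactly one $(c,d)\in\mathbb Z_N^2$ (here $\xi^{-c}$ is the convolution power, the character with $g\mapsto q^{c}$ and $x,y\mapsto 0$); the pair $(g^d,\xi^{-c})$ is a pair in involution if and only if $(c,d)$ satisfies (1), and it is a modular pair in involution if and only if, in addition, $cd=0$ in $\mathbb Z_N$. -/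

import Mathlib

open scoped TensorProduct

/-! ### Pairs in involution -/

section PairInInvolution

variable {k H : Type*} [Field k] [Ring H] [HopfAlgebra k H]

/-- The convolution inverse `β⁻¹ = β ∘ S` of a character `β : H → k`. -/
noncomputable def characterInv (β : H →ₐ[k] k) : H →ₗ[k] k :=
  β.toLinearMap ∘ₗ HopfAlgebra.antipode k

/-- `β⁻¹` is the two-sided inverse of `β` for the convolution product. -/
theorem characterInv_spec (β : H →ₐ[k] k) :
    WithConv.toConv (characterInv β) * WithConv.toConv β.toLinearMap = 1 ∧
    WithConv.toConv β.toLinearMap * WithConv.toConv (characterInv β) = 1 := by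
  constructor <;> ext h
  · have := congrArg β (HopfAlgebra.sum_antipode_mul_eq_algebraMap_counit (Coalgebra.Repr.arbitrary k h))
    rw [(Coalgebra.Repr.arbitrary k h).convMul_apply]
    simpa [characterInv] using this
  · have := congrArg β (HopfAlgebra.sum_mul_antipode_eq_algebraMap_counit (Coalgebra.Repr.arbitrary k h))
    rw [(Coalgebra.Repr.arbitrary k h).convMul_apply]
    simpa [characterInv] using this

/-- The linear map `h ↦ l h l⁻¹` attached to a group-like `l`. -/
noncomputable def groupLikeConj (l : GroupLike k H) : H →ₗ[k] H :=
  LinearMap.mulLeft k (l : H) ∘ₗ LinearMap.mulRight k ((l⁻¹ : GroupLike k H) : H)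

/-- The linear map `h ↦ β⁻¹(h₍₁₎) β(h₍₃₎) l h₍₂₎ l⁻¹`. -/
noncomputable def involutionMap (l : GroupLike k H) (β : H →ₐ[k] k) : H →ₗ[k] H :=
  (TensorProduct.lid k H).toLinearMap ∘ₗ
    TensorProduct.map (characterInv β)
      ((TensorProduct.rid k H).toLinearMap ∘ₗ
        TensorProduct.map (groupLikeConj l) β.toLinearMap) ∘ₗ
    Coalgebra.comul.lTensor H ∘ₗ Coalgebra.comul

/-- `(l, β)` is a pair in involution:
`S²(h) = β(h₍₃₎) β⁻¹(h₍₁₎) l h₍₂₎ l⁻¹` for all `h`. The group-likes of the finite dual `H°` are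
the characters of `H`, i.e. the algebra homomorphisms `H → k`. -/
def IsPairInInvolution (l : GroupLike k H) (β : H →ₐ[k] k) : Prop :=
  ∀ h : H, HopfAlgebra.antipode k (HopfAlgebra.antipode k h) = involutionMap l β h

/-- A pair in involution `(l, β)` with `β(l) = 1`. -/
def IsModularPairInInvolution (l : GroupLike k H) (β : H →ₐ[k] k) : Prop :=
  IsPairInInvolution l β ∧ β (l : H) = 1

end PairInInvolution

/-! ### Powers of sums of `ζ`-commuting elements -/

namespace QBinomial

variable {k : Type*} [Field k]

def coeff (ζ : k) : ℕ → ℕ → k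
  | 0, _ => 1
  | _ + 1, 0 => 1
  | i + 1, j + 1 => coeff ζ i (j + 1) + ζ ^ (i + 1) * coeff ζ (i + 1) j

def num (ζ : k) (n : ℕ) : k := ∑ s ∈ Finset.range n, ζ ^ s

def fact (ζ : k) (n : ℕ) : k := ∏ t ∈ Finset.range n, num ζ (t + 1)

theorem num_add (ζ : k) (i j : ℕ) : num ζ (i + j) = num ζ i + ζ ^ i * num ζ j := by
  simp [num, Finset.sum_range_add, pow_add, Finset.mul_sum]

theorem fact_succ (ζ : k) (n : ℕ) : fact ζ (n + 1) = fact ζ n * num ζ (n + 1) := by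
  simp [fact, Finset.prod_range_succ]

theorem coeff_mul_fact (ζ : k) (i j : ℕ) :
    coeff ζ i j * (fact ζ i * fact ζ j) = fact ζ (i + j) := by
  induction i generalizing j with
  | zero => simp [coeff, fact]
  | succ i ih =>
    induction j with
    | zero => simp [coeff, fact]
    | succ j ihj =>
      have h1 := ih (j + 1)
      have e : i + 1 + (j + 1) = (i + 1 + j) + 1 := by ring
      have e2 : num ζ (i + 1 + j + 1) = num ζ (i + 1) + ζ ^ (i + 1) * num ζ (j + 1) := by
        rw [add_assoc (i + 1), num_add]
      rw [e, fact_succ ζ (i + 1 + j), e2, coeff]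
      have e3 : i + (j + 1) = i + 1 + j := by ring
      rw [e3] at h1
      calc _ = num ζ (i + 1) * (coeff ζ i (j + 1) * (fact ζ i * fact ζ (j + 1)))
          + ζ ^ (i + 1) * num ζ (j + 1) * (coeff ζ (i + 1) j * (fact ζ (i + 1) * fact ζ j)) := by
            rw [fact_succ ζ i, fact_succ ζ j]; ring
        _ = _ := by rw [h1, ihj]; ring

theorem coeff_eq_zero {ζ : k} {n : ℕ} (hζ : IsPrimitiveRoot ζ n) {i j : ℕ} (hi : i ≠ 0)
    (hj : j ≠ 0) (hij : i + j = n) : coeff ζ i j = 0 := by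
  have hne : ζ ≠ 1 := fun h => by
    have := (hζ.dvd_of_pow_eq_one 1 (by simp [h])); have := Nat.le_of_dvd one_pos this; omega
  have hnum : ∀ m, 0 < m → m < n → num ζ m ≠ 0 := by
    intro m hm hmn h0
    have := geom_sum_mul ζ m
    rw [show ∑ i ∈ Finset.range m, ζ ^ i = 0 from h0, zero_mul] at this
    exact hζ.pow_ne_one_of_pos_of_lt hm.ne' hmn (sub_eq_zero.mp this.symm)
  have hn : num ζ n = 0 := by
    have := geom_sum_mul ζ n
    rw [hζ.pow_eq_one, sub_self] at this
    exact (mul_eq_zero.mp this).resolve_right (sub_ne_zero.mpr hne)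
  have hf : ∀ m, m < n → fact ζ m ≠ 0 := by
    intro m hm
    refine Finset.prod_ne_zero_iff.mpr fun t ht => hnum _ (by omega) ?_
    have := Finset.mem_range.mp ht; omega
  have h := coeff_mul_fact ζ i j
  obtain ⟨m, rfl⟩ : ∃ m, n = m + 1 := ⟨n - 1, by omega⟩
  rw [hij, fact_succ, hn, mul_zero] at h
  exact (mul_eq_zero.mp h).resolve_right (mul_ne_zero (hf i (by omega)) (hf j (by omega)))

theorem mul_pow_comm {E : Type*} [Ring E] [Algebra k E] {ζ : k} {A B : E}
    (h : B * A = ζ • (A * B)) (i : ℕ) : B * A ^ i = ζ ^ i • (A ^ i * B) := by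
  induction i with
  | zero => simp
  | succ i ih =>
    rw [pow_succ, ← mul_assoc, ih, smul_mul_assoc, mul_assoc, h, mul_smul_comm, smul_smul,
      ← pow_succ, ← mul_assoc]

theorem sum_pow {E : Type*} [Ring E] [Algebra k E] {ζ : k} {A B : E}
    (h : B * A = ζ • (A * B)) (m : ℕ) :
    (A + B) ^ m = ∑ p ∈ Finset.HasAntidiagonal.antidiagonal m, coeff ζ p.1 p.2 • (A ^ p.1 * B ^ p.2) := by
  induction m with
  | zero => simp [coeff]
  | succ m ih =>
    let F1 : ℕ × ℕ → E := fun p =>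
      (match p.1 with | 0 => 0 | i + 1 => coeff ζ i p.2) • (A ^ p.1 * B ^ p.2)
    let F2 : ℕ × ℕ → E := fun p =>
      (match p.2 with | 0 => 0 | j + 1 => ζ ^ p.1 * coeff ζ p.1 j) • (A ^ p.1 * B ^ p.2)
    have hF : ∀ p ∈ Finset.HasAntidiagonal.antidiagonal (m + 1),
        coeff ζ p.1 p.2 • (A ^ p.1 * B ^ p.2) = F1 p + F2 p := by
      rintro ⟨i, j⟩ hp
      have hp := Finset.HasAntidiagonal.mem_antidiagonal.mp hp
      rcases i with _ | i <;> rcases j with _ | j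
      · simp at hp
      · simp [F1, F2, coeff]
      · cases i <;> simp [F1, F2, coeff]
      · simp [F1, F2, coeff, add_smul]
    rw [Finset.sum_congr rfl hF, Finset.sum_add_distrib, Finset.Nat.sum_antidiagonal_succ,
      Finset.Nat.sum_antidiagonal_succ', pow_succ', ih, add_mul, Finset.mul_sum, Finset.mul_sum]
    simp only [F1, F2, zero_smul, zero_add, add_zero]
    congr 1
    · refine Finset.sum_congr rfl fun p _ => ?_
      rw [mul_smul_comm, ← mul_assoc, ← pow_succ']
    · refine Finset.sum_congr rfl fun p _ => ?_
      rw [mul_smul_comm, ← mul_assoc, mul_pow_comm h, smul_mul_assoc, smul_smul, mul_assoc,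
        ← pow_succ', mul_comm]

theorem add_pow_eq_zero {E : Type*} [Ring E] [Algebra k E] {ζ : k} {A B : E} {n : ℕ}
    (hζ : IsPrimitiveRoot ζ n) (h : B * A = ζ • (A * B)) (hA : A ^ n = 0) (hB : B ^ n = 0) :
    (A + B) ^ n = 0 := by
  rw [sum_pow h]
  refine Finset.sum_eq_zero fun p hp => ?_
  have hp := Finset.HasAntidiagonal.mem_antidiagonal.mp hp
  by_cases h1 : p.1 = 0
  · have : p.2 = n := by omega
    simp [this, hB]
  by_cases h2 : p.2 = 0
  · have : p.1 = n := by omega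
    simp [this, hA]
  rw [coeff_eq_zero hζ h1 h2 hp, zero_smul]

theorem prod_pow {E : Type*} [Ring E] [Algebra k E] {ζ : k} {A B : E}
    (h : B * A = ζ • (A * B)) (n : ℕ) : ∃ c : k, (A * B) ^ n = c • (A ^ n * B ^ n) := by
  have hB : ∀ n, B ^ n * A = ζ ^ n • (A * B ^ n) := by
    intro n
    induction n with
    | zero => simp
    | succ n ih =>
      rw [pow_succ, mul_assoc, h, mul_smul_comm, ← mul_assoc, ih, smul_mul_assoc, smul_smul,
        ← pow_succ', mul_assoc]
  induction n with
  | zero => exact ⟨1, by simp⟩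
  | succ n ih =>
    obtain ⟨c, hc⟩ := ih
    refine ⟨c * ζ ^ n, ?_⟩
    rw [pow_succ, hc, smul_mul_assoc, mul_assoc, ← mul_assoc (B ^ n), hB, smul_mul_assoc,
      mul_smul_comm, smul_smul, mul_assoc A, ← pow_succ, ← mul_assoc, ← pow_succ]

end QBinomial

/-! ### Generalised Taft algebras -/

/-- Parameters of a generalised Taft algebra: an integer `N ≥ 2`, a primitive `N`-th root of unity
`q`, and `a₁, a₂, b₁, b₂ ∈ ℤ/N` with `a₁ b₁ ≠ 0`, `a₂ b₂ ≠ 0` and `a₁ b₂ + a₂ b₁ = 0`. -/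
structure TaftParams (k : Type*) [Field k] (N : ℕ) where
  q : k
  a₁ : ZMod N
  a₂ : ZMod N
  b₁ : ZMod N
  b₂ : ZMod N
  two_le : 2 ≤ N
  primitive : IsPrimitiveRoot q N
  ne₁ : a₁ * b₁ ≠ 0
  ne₂ : a₂ * b₂ ≠ 0
  cross : a₁ * b₂ + a₂ * b₁ = 0

namespace TaftParams

variable {k : Type*} [Field k] {N : ℕ} (P : TaftParams k N)

/-- `N_x`, the order of `a₁ b₁` in `ℤ/N`. -/
noncomputable def Nx : ℕ := addOrderOf (P.a₁ * P.b₁)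

/-- `N_y`, the order of `a₂ b₂` in `ℤ/N`. -/
noncomputable def Ny : ℕ := addOrderOf (P.a₂ * P.b₂)

/-- `q ^ a` for `a ∈ ℤ/N`. -/
def qpow (a : ZMod N) : k := P.q ^ a.val

theorem neZero (P : TaftParams k N) : NeZero N := ⟨by have := P.two_le; omega⟩

theorem pow_val_add {M : Type*} [Monoid M] {u : M} (h : u ^ N = 1) [NeZero N] (a b : ZMod N) :
    u ^ (a + b).val = u ^ a.val * u ^ b.val := by
  rw [ZMod.val_add, ← pow_add, ← pow_mod_orderOf, ← pow_mod_orderOf (n := a.val + b.val),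
    Nat.mod_mod_of_dvd _ (orderOf_dvd_of_pow_eq_one h)]

theorem qpow_add (a b : ZMod N) : P.qpow (a + b) = P.qpow a * P.qpow b :=
  have := P.neZero
  pow_val_add P.primitive.pow_eq_one a b

theorem qpow_zero : P.qpow 0 = 1 := by
  simp [qpow]

theorem qpow_nsmul (n : ℕ) (a : ZMod N) : P.qpow (n • a) = P.qpow a ^ n := by
  induction n with
  | zero => simp [qpow_zero]
  | succ n ih => rw [succ_nsmul, qpow_add, ih, pow_succ]

theorem qpow_eq_one_iff (a : ZMod N) : P.qpow a = 1 ↔ a = 0 := by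
  have := P.neZero
  rw [qpow, P.primitive.pow_eq_one_iff_dvd]
  constructor
  · intro h
    rw [← ZMod.val_eq_zero]
    exact Nat.eq_zero_of_dvd_of_lt h (ZMod.val_lt a)
  · rintro rfl; simp

theorem qpow_primitive (a : ZMod N) : IsPrimitiveRoot (P.qpow a) (addOrderOf a) where
  pow_eq_one := by rw [← qpow_nsmul, addOrderOf_nsmul_eq_zero, qpow_zero]
  dvd_of_pow_eq_one l h := by
    rw [← qpow_nsmul, qpow_eq_one_iff] at h
    exact addOrderOf_dvd_of_nsmul_eq_zero h

theorem Nx_ne_zero : P.Nx ≠ 0 :=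
  have := P.neZero
  (addOrderOf_pos _).ne'

theorem Ny_ne_zero : P.Ny ≠ 0 :=
  have := P.neZero
  (addOrderOf_pos _).ne'

end TaftParams

/-- The generators of a generalised Taft algebra. -/
inductive TaftGen
  | g
  | x
  | y

open FreeAlgebra in
/-- The defining relations of `H_q(a₁, a₂, b₁, b₂)` in the free algebra on `g, x, y`. -/
inductive TaftRel {k : Type*} [Field k] {N : ℕ} (P : TaftParams k N) :
    FreeAlgebra k TaftGen → FreeAlgebra k TaftGen → Prop
  | g_pow : TaftRel P (ι k .g ^ N) 1
  | x_pow : TaftRel P (ι k .x ^ P.Nx) 0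
  | y_pow : TaftRel P (ι k .y ^ P.Ny) 0
  | g_x : TaftRel P (ι k .g * ι k .x) (P.qpow P.b₁ • (ι k .x * ι k .g))
  | g_y : TaftRel P (ι k .g * ι k .y) (P.qpow P.b₂ • (ι k .y * ι k .g))
  | x_y : TaftRel P (ι k .x * ι k .y) (P.qpow (P.a₁ * P.b₂) • (ι k .y * ι k .x))

/-- The generalised Taft algebra `H_q(a₁, a₂, b₁, b₂)`, as an algebra. -/
def TaftAlgebra {k : Type*} [Field k] {N : ℕ} (P : TaftParams k N) : Type _ :=
  RingQuot (TaftRel P)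

namespace TaftAlgebra

variable {k : Type*} [Field k] {N : ℕ} (P : TaftParams k N)

instance instRing : Ring (TaftAlgebra P) := inferInstanceAs (Ring (RingQuot (TaftRel P)))

instance instAlgebra : Algebra k (TaftAlgebra P) :=
  inferInstanceAs (Algebra k (RingQuot (TaftRel P)))

/-- The quotient map from the free algebra. -/
noncomputable def mk : FreeAlgebra k TaftGen →ₐ[k] TaftAlgebra P := RingQuot.mkAlgHom k (TaftRel P)

noncomputable def g : TaftAlgebra P := mk P (FreeAlgebra.ι k .g)
noncomputable def x : TaftAlgebra P := mk P (FreeAlgebra.ι k .x)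
noncomputable def y : TaftAlgebra P := mk P (FreeAlgebra.ι k .y)

/-- `g ^ a` for `a ∈ ℤ/N`. -/
noncomputable def gpow (a : ZMod N) : TaftAlgebra P := g P ^ a.val

/-- The relations, for three elements of an arbitrary algebra. -/
structure Relations {A : Type*} [Ring A] [Algebra k A] (G X Y : A) : Prop where
  g_pow : G ^ N = 1
  x_pow : X ^ P.Nx = 0
  y_pow : Y ^ P.Ny = 0
  g_x : G * X = P.qpow P.b₁ • (X * G)
  g_y : G * Y = P.qpow P.b₂ • (Y * G)
  x_y : X * Y = P.qpow (P.a₁ * P.b₂) • (Y * X)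

theorem relations : Relations P (g P) (x P) (y P) where
  g_pow := by
    have := RingQuot.mkAlgHom_rel k (TaftRel.g_pow (P := P))
    simp only [map_pow, map_mul, map_one, map_zero, map_smul] at this
    exact this
  x_pow := by
    have := RingQuot.mkAlgHom_rel k (TaftRel.x_pow (P := P))
    simp only [map_pow, map_mul, map_one, map_zero, map_smul] at this
    exact this
  y_pow := by
    have := RingQuot.mkAlgHom_rel k (TaftRel.y_pow (P := P))
    simp only [map_pow, map_mul, map_one, map_zero, map_smul] at this
    exact this
  g_x := by
    have := RingQuot.mkAlgHom_rel k (TaftRel.g_x (P := P))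
    simp only [map_pow, map_mul, map_one, map_zero, map_smul] at this
    exact this
  g_y := by
    have := RingQuot.mkAlgHom_rel k (TaftRel.g_y (P := P))
    simp only [map_pow, map_mul, map_one, map_zero, map_smul] at this
    exact this
  x_y := by
    have := RingQuot.mkAlgHom_rel k (TaftRel.x_y (P := P))
    simp only [map_pow, map_mul, map_one, map_zero, map_smul] at this
    exact this

section lift

variable {P} {A : Type*} [Ring A] [Algebra k A]

/-- The images of the generators. -/
def genMap (G X Y : A) : TaftGen → A
  | .g => G
  | .x => X
  | .y => Y

/-- The universal property of the presentation. -/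
noncomputable def lift {G X Y : A} (h : Relations P G X Y) : TaftAlgebra P →ₐ[k] A :=
  RingQuot.liftAlgHom k ⟨FreeAlgebra.lift k (genMap G X Y), by
    intro u v huv
    cases huv with
    | g_pow => simpa [genMap] using h.g_pow
    | x_pow => simpa [genMap] using h.x_pow
    | y_pow => simpa [genMap] using h.y_pow
    | g_x => simpa [genMap] using h.g_x
    | g_y => simpa [genMap] using h.g_y
    | x_y => simpa [genMap] using h.x_y⟩

theorem lift_mk {G X Y : A} (h : Relations P G X Y) (u : FreeAlgebra k TaftGen) :
    lift h (mk P u) = FreeAlgebra.lift k (genMap G X Y) u :=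
  RingQuot.liftAlgHom_mkAlgHom_apply k _ _ u

@[simp] theorem lift_g {G X Y : A} (h : Relations P G X Y) : lift h (g P) = G := by
  rw [g, lift_mk, FreeAlgebra.lift_ι_apply]; rfl

@[simp] theorem lift_x {G X Y : A} (h : Relations P G X Y) : lift h (x P) = X := by
  rw [x, lift_mk, FreeAlgebra.lift_ι_apply]; rfl

@[simp] theorem lift_y {G X Y : A} (h : Relations P G X Y) : lift h (y P) = Y := by
  rw [y, lift_mk, FreeAlgebra.lift_ι_apply]; rfl

@[simp] theorem lift_gpow {G X Y : A} (h : Relations P G X Y) (a : ZMod N) :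
    lift h (gpow P a) = G ^ a.val := by
  rw [gpow, map_pow, lift_g]

theorem algHom_ext {f f' : TaftAlgebra P →ₐ[k] A} (hg : f (g P) = f' (g P))
    (hx : f (x P) = f' (x P)) (hy : f (y P) = f' (y P)) : f = f' := by
  refine RingQuot.ringQuot_ext' k f f' (FreeAlgebra.hom_ext (funext fun t => ?_))
  cases t
  exacts [hg, hx, hy]

end lift

theorem gen_induction {p : TaftAlgebra P → Prop} (hs : ∀ r : k, p (algebraMap k _ r))
    (hg : p (g P)) (hx : p (x P)) (hy : p (y P)) (hmul : ∀ u v, p u → p v → p (u * v))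
    (hadd : ∀ u v, p u → p v → p (u + v)) (u : TaftAlgebra P) : p u := by
  obtain ⟨w, rfl⟩ : ∃ w, mk P w = u := RingQuot.mkAlgHom_surjective k (TaftRel P) u
  induction w using FreeAlgebra.induction with
  | grade0 r => rw [AlgHom.commutes]; exact hs r
  | grade1 t => cases t; exacts [hg, hx, hy]
  | mul a b ha hb => rw [map_mul]; exact hmul _ _ ha hb
  | add a b ha hb => rw [map_add]; exact hadd _ _ ha hb

theorem gpow_add (a b : ZMod N) : gpow P (a + b) = gpow P a * gpow P b :=
  have := P.neZero
  TaftParams.pow_val_add (relations P).g_pow a b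

@[simp] theorem gpow_zero : gpow P 0 = 1 := by simp [gpow]

theorem gpow_one : gpow P 1 = g P := by
  have : Fact (1 < N) := ⟨P.two_le⟩
  rw [gpow, ZMod.val_one, pow_one]

theorem gpow_nsmul (n : ℕ) (a : ZMod N) : gpow P (n • a) = gpow P a ^ n := by
  induction n with
  | zero => simp
  | succ n ih => rw [succ_nsmul, gpow_add, ih, pow_succ]

theorem gpow_mul_neg (a : ZMod N) : gpow P a * gpow P (-a) = 1 := by
  rw [← gpow_add, add_neg_cancel, gpow_zero]

theorem gpow_neg_mul (a : ZMod N) : gpow P (-a) * gpow P a = 1 := by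
  rw [← gpow_add, neg_add_cancel, gpow_zero]

theorem pow_mul_comm' {A : Type*} [Ring A] [Algebra k A] {G X : A} {b : ZMod N}
    (h : G * X = P.qpow b • (X * G)) (a : ZMod N) :
    G ^ a.val * X = P.qpow (a * b) • (X * G ^ a.val) := by
  have := P.neZero
  have key : ∀ n : ℕ, G ^ n * X = P.qpow (n • b) • (X * G ^ n) := by
    intro n
    induction n with
    | zero => simp [P.qpow_zero]
    | succ n ih =>
      rw [pow_succ, mul_assoc, h, mul_smul_comm, ← mul_assoc, ih, smul_mul_assoc, smul_smul,
        mul_assoc, ← P.qpow_add, succ_nsmul, add_comm]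
  rw [key, nsmul_eq_mul, ZMod.natCast_zmod_val]

theorem gpow_x (a : ZMod N) : gpow P a * x P = P.qpow (a * P.b₁) • (x P * gpow P a) :=
  pow_mul_comm' P (relations P).g_x a

theorem gpow_y (a : ZMod N) : gpow P a * y P = P.qpow (a * P.b₂) • (y P * gpow P a) :=
  pow_mul_comm' P (relations P).g_y a

theorem comulRelations : Relations P (A := TaftAlgebra P ⊗[k] TaftAlgebra P)
    (g P ⊗ₜ g P) (1 ⊗ₜ x P + x P ⊗ₜ gpow P P.a₁) (1 ⊗ₜ y P + y P ⊗ₜ gpow P P.a₂) where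
  g_pow := by
    rw [Algebra.TensorProduct.tmul_pow, (relations P).g_pow, Algebra.TensorProduct.one_def]
  x_pow := by
    refine QBinomial.add_pow_eq_zero (P.qpow_primitive _) ?_ ?_ ?_
    · simp [gpow_x]
    · rw [Algebra.TensorProduct.tmul_pow]
      erw [(relations P).x_pow]; simp
    · rw [Algebra.TensorProduct.tmul_pow]
      erw [(relations P).x_pow]; simp
  y_pow := by
    refine QBinomial.add_pow_eq_zero (P.qpow_primitive _) ?_ ?_ ?_
    · simp [gpow_y]
    · rw [Algebra.TensorProduct.tmul_pow]
      erw [(relations P).y_pow]; simp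
    · rw [Algebra.TensorProduct.tmul_pow]
      erw [(relations P).y_pow]; simp
  g_x := by
    have hc : g P * gpow P P.a₁ = gpow P P.a₁ * g P := by
      rw [← gpow_one, ← gpow_add, ← gpow_add, add_comm]
    simp only [mul_add, add_mul, Algebra.TensorProduct.tmul_mul_tmul, mul_one, one_mul,
      (relations P).g_x, hc, smul_add, TensorProduct.tmul_smul, TensorProduct.smul_tmul']
  g_y := by
    have hc : g P * gpow P P.a₂ = gpow P P.a₂ * g P := by
      rw [← gpow_one, ← gpow_add, ← gpow_add, add_comm]
    simp only [mul_add, add_mul, Algebra.TensorProduct.tmul_mul_tmul, mul_one, one_mul,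
      (relations P).g_y, hc, smul_add, TensorProduct.tmul_smul, TensorProduct.smul_tmul']
  x_y := by
    have hc : gpow P P.a₂ * gpow P P.a₁ = gpow P P.a₁ * gpow P P.a₂ := by
      rw [← gpow_add, ← gpow_add, add_comm]
    have h1 : P.qpow (P.a₁ * P.b₂) * P.qpow (P.a₂ * P.b₁) = 1 := by
      rw [← P.qpow_add, P.cross, P.qpow_zero]
    simp only [mul_add, add_mul, Algebra.TensorProduct.tmul_mul_tmul, mul_one, one_mul,
      (relations P).x_y, gpow_x, gpow_y, hc, smul_add, TensorProduct.tmul_smul,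
      ← TensorProduct.smul_tmul', smul_smul, h1, one_smul]
    abel

theorem counitRelations : Relations P (A := k) 1 0 0 where
  g_pow := one_pow _
  x_pow := zero_pow P.Nx_ne_zero
  y_pow := zero_pow P.Ny_ne_zero
  g_x := by simp
  g_y := by simp
  x_y := by simp

/-- `Δ(g) = g ⊗ g`, `Δ(x) = 1 ⊗ x + x ⊗ g^{a₁}`, `Δ(y) = 1 ⊗ y + y ⊗ g^{a₂}`. -/
noncomputable def comulHom : TaftAlgebra P →ₐ[k] TaftAlgebra P ⊗[k] TaftAlgebra P :=
  lift (comulRelations P)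

/-- `ε(g) = 1`, `ε(x) = ε(y) = 0`. -/
noncomputable def counitHom : TaftAlgebra P →ₐ[k] k := lift (counitRelations P)

theorem comulHom_gpow (a : ZMod N) : comulHom P (gpow P a) = gpow P a ⊗ₜ gpow P a := by
  rw [comulHom, lift_gpow, Algebra.TensorProduct.tmul_pow]; rfl

theorem counitHom_gpow (a : ZMod N) : counitHom P (gpow P a) = 1 := by
  rw [counitHom, lift_gpow, one_pow]

noncomputable instance instBialgebra : Bialgebra k (TaftAlgebra P) :=
  Bialgebra.ofAlgHom (comulHom P) (counitHom P)
    (by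
      apply algHom_ext <;>
      simp [comulHom, TensorProduct.tmul_add, TensorProduct.add_tmul,
        Algebra.TensorProduct.one_def, ← Algebra.TensorProduct.tmul_pow, gpow, add_assoc])
    (by
      apply algHom_ext <;> simp [comulHom, counitHom])
    (by
      apply algHom_ext <;> simp [comulHom, counitHom])

@[simp] theorem comul_apply (u : TaftAlgebra P) :
    Coalgebra.comul (R := k) u = comulHom P u := rfl

@[simp] theorem counit_apply (u : TaftAlgebra P) :
    Coalgebra.counit (R := k) u = counitHom P u := rfl

theorem comulHom_x : comulHom P (x P) = 1 ⊗ₜ x P + x P ⊗ₜ gpow P P.a₁ := lift_x _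

theorem comulHom_y : comulHom P (y P) = 1 ⊗ₜ y P + y P ⊗ₜ gpow P P.a₂ := lift_y _

open MulOpposite in
theorem antipodeRelations : Relations P (A := (TaftAlgebra P)ᵐᵒᵖ)
    (op (gpow P (-1))) (op (-(x P * gpow P (-P.a₁)))) (op (-(y P * gpow P (-P.a₂)))) where
  g_pow := by
    rw [← op_pow, ← gpow_nsmul, nsmul_eq_mul, ZMod.natCast_self, zero_mul, gpow_zero, op_one]
  x_pow := by
    obtain ⟨c, hc⟩ := QBinomial.prod_pow (gpow_x P (-P.a₁)) P.Nx
    rw [← op_pow, neg_pow, hc, (relations P).x_pow]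
    simp
  y_pow := by
    obtain ⟨c, hc⟩ := QBinomial.prod_pow (gpow_y P (-P.a₂)) P.Ny
    rw [← op_pow, neg_pow, hc, (relations P).y_pow]
    simp
  g_x := by
    rw [← op_mul, ← op_mul, ← op_smul]
    congr 1
    rw [mul_neg, neg_mul, smul_neg, ← mul_assoc, gpow_x, smul_mul_assoc, smul_smul, ← P.qpow_add,
      mul_assoc, mul_assoc, ← gpow_add, ← gpow_add, add_comm (-P.a₁)]
    simp [P.qpow_zero]
  g_y := by
    rw [← op_mul, ← op_mul, ← op_smul]
    congr 1
    rw [mul_neg, neg_mul, smul_neg, ← mul_assoc, gpow_y, smul_mul_assoc, smul_smul, ← P.qpow_add,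
      mul_assoc, mul_assoc, ← gpow_add, ← gpow_add, add_comm (-P.a₂)]
    simp [P.qpow_zero]
  x_y := by
    rw [← op_mul, ← op_mul, ← op_smul]
    congr 1
    have e1 : y P * gpow P (-P.a₂) * (x P * gpow P (-P.a₁)) =
        P.qpow (-P.a₂ * P.b₁) • (y P * x P * gpow P (-P.a₁ + -P.a₂)) := by
      rw [mul_assoc, ← mul_assoc (gpow P _), gpow_x, smul_mul_assoc, mul_smul_comm, mul_assoc (x P),
        ← gpow_add, ← mul_assoc, add_comm]
    have e2 : x P * gpow P (-P.a₁) * (y P * gpow P (-P.a₂)) =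
        P.qpow (-P.a₁ * P.b₂) • (x P * y P * gpow P (-P.a₁ + -P.a₂)) := by
      rw [mul_assoc, ← mul_assoc (gpow P _), gpow_y, smul_mul_assoc, mul_smul_comm, mul_assoc (y P),
        ← gpow_add, ← mul_assoc]
    rw [neg_mul_neg, neg_mul_neg, e1, e2, (relations P).x_y, smul_mul_assoc, smul_smul, smul_smul,
      ← P.qpow_add, ← P.qpow_add]
    congr 2
    have := P.cross
    linear_combination -this

/-- `S(g) = g⁻¹`, `S(x) = -x g^{-a₁}`, `S(y) = -y g^{-a₂}`, extended to an anti-homomorphism. -/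
noncomputable def antipodeHom : TaftAlgebra P →ₐ[k] (TaftAlgebra P)ᵐᵒᵖ := lift (antipodeRelations P)

/-- The antipode as a linear map. -/
noncomputable def antipodeLin : TaftAlgebra P →ₗ[k] TaftAlgebra P :=
  (MulOpposite.opLinearEquiv k).symm.toLinearMap ∘ₗ (antipodeHom P).toLinearMap

theorem antipodeLin_apply (u : TaftAlgebra P) :
    antipodeLin P u = (antipodeHom P u).unop := rfl

theorem antipodeLin_mul (u v : TaftAlgebra P) :
    antipodeLin P (u * v) = antipodeLin P v * antipodeLin P u := by
  simp [antipodeLin_apply]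

theorem antipodeLin_one : antipodeLin P 1 = 1 := by
  simp [antipodeLin_apply]

theorem antipodeLin_g : antipodeLin P (g P) = gpow P (-1) := by
  simp [antipodeLin_apply, antipodeHom]

theorem antipodeLin_x : antipodeLin P (x P) = -(x P * gpow P (-P.a₁)) := by
  simp [antipodeLin_apply, antipodeHom]

theorem antipodeLin_y : antipodeLin P (y P) = -(y P * gpow P (-P.a₂)) := by
  simp [antipodeLin_apply, antipodeHom]

theorem antipodeLin_gpow (a : ZMod N) : antipodeLin P (gpow P a) = gpow P (-a) := by
  have := P.neZero
  rw [antipodeLin_apply, antipodeHom, lift_gpow, MulOpposite.unop_pow, MulOpposite.unop_op,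
    ← gpow_nsmul, nsmul_eq_mul, ZMod.natCast_zmod_val, mul_neg, mul_one]

/-- `u ⊗ v ↦ S(u) v`. -/
noncomputable def leftConv : TaftAlgebra P ⊗[k] TaftAlgebra P →ₗ[k] TaftAlgebra P :=
  LinearMap.mul' k _ ∘ₗ (antipodeLin P).rTensor _

/-- `u ⊗ v ↦ u S(v)`. -/
noncomputable def rightConv : TaftAlgebra P ⊗[k] TaftAlgebra P →ₗ[k] TaftAlgebra P :=
  LinearMap.mul' k _ ∘ₗ (antipodeLin P).lTensor _

@[simp] theorem leftConv_tmul (u v : TaftAlgebra P) :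
    leftConv P (u ⊗ₜ v) = antipodeLin P u * v := rfl

@[simp] theorem rightConv_tmul (u v : TaftAlgebra P) :
    rightConv P (u ⊗ₜ v) = u * antipodeLin P v := rfl

theorem leftConv_mul {s : TaftAlgebra P ⊗[k] TaftAlgebra P} {r : k}
    (hs : leftConv P s = algebraMap k _ r) (t : TaftAlgebra P ⊗[k] TaftAlgebra P) :
    leftConv P (s * t) = r • leftConv P t := by
  have key : ∀ (s : TaftAlgebra P ⊗[k] TaftAlgebra P) (u v : TaftAlgebra P),
      leftConv P (s * (u ⊗ₜ v)) = antipodeLin P u * leftConv P s * v := by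
    intro s u v
    induction s using TensorProduct.induction_on with
    | zero => simp
    | tmul a b => simp [antipodeLin_mul, mul_assoc]
    | add a b ha hb => simp only [add_mul, mul_add, map_add, ha, hb]
  induction t using TensorProduct.induction_on with
  | zero => simp
  | tmul u v =>
    rw [key, hs, leftConv_tmul, ← Algebra.commutes, mul_assoc, Algebra.smul_def]
  | add a b ha hb => rw [mul_add, map_add, map_add, ha, hb, smul_add]

theorem rightConv_mul (s : TaftAlgebra P ⊗[k] TaftAlgebra P) {r : k}
    {t : TaftAlgebra P ⊗[k] TaftAlgebra P} (ht : rightConv P t = algebraMap k _ r) :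
    rightConv P (s * t) = r • rightConv P s := by
  have key : ∀ (t : TaftAlgebra P ⊗[k] TaftAlgebra P) (u v : TaftAlgebra P),
      rightConv P ((u ⊗ₜ v) * t) = u * rightConv P t * antipodeLin P v := by
    intro t u v
    induction t using TensorProduct.induction_on with
    | zero => simp
    | tmul a b => simp [antipodeLin_mul, mul_assoc]
    | add a b ha hb => simp only [add_mul, mul_add, map_add, ha, hb]
  induction s using TensorProduct.induction_on with
  | zero => simp
  | tmul u v =>
    rw [key, ht, rightConv_tmul, ← Algebra.commutes, mul_assoc, Algebra.smul_def]
  | add a b ha hb => rw [add_mul, map_add, map_add, ha, hb, smul_add]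

theorem leftConv_comul (u : TaftAlgebra P) :
    leftConv P (comulHom P u) = algebraMap k _ (counitHom P u) := by
  induction u using gen_induction with
  | hs r =>
    rw [AlgHom.commutes, AlgHom.commutes, Algebra.TensorProduct.algebraMap_apply, leftConv_tmul,
      mul_one, Algebra.algebraMap_eq_smul_one, map_smul, antipodeLin_one]
    simp [Algebra.algebraMap_eq_smul_one]
  | hg =>
    rw [← gpow_one, comulHom_gpow, counitHom_gpow, leftConv_tmul, antipodeLin_gpow, gpow_neg_mul,
      map_one]
  | hx =>
    rw [comulHom_x, counitHom, lift_x, map_add, leftConv_tmul, leftConv_tmul, antipodeLin_one,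
      antipodeLin_x, neg_mul, mul_assoc, gpow_neg_mul]
    simp
  | hy =>
    rw [comulHom_y, counitHom, lift_y, map_add, leftConv_tmul, leftConv_tmul, antipodeLin_one,
      antipodeLin_y, neg_mul, mul_assoc, gpow_neg_mul]
    simp
  | hmul u v hu hv =>
    rw [map_mul, leftConv_mul P hu, hv, map_mul, map_mul, Algebra.smul_def]
  | hadd u v hu hv => rw [map_add, map_add, hu, hv, map_add, map_add]

theorem rightConv_comul (u : TaftAlgebra P) :
    rightConv P (comulHom P u) = algebraMap k _ (counitHom P u) := by
  induction u using gen_induction with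
  | hs r =>
    rw [AlgHom.commutes, AlgHom.commutes, Algebra.TensorProduct.algebraMap_apply, rightConv_tmul,
      antipodeLin_one, mul_one]
    simp
  | hg =>
    rw [← gpow_one, comulHom_gpow, counitHom_gpow, rightConv_tmul, antipodeLin_gpow, gpow_mul_neg,
      map_one]
  | hx =>
    rw [comulHom_x, counitHom, lift_x, map_add, rightConv_tmul, rightConv_tmul, antipodeLin_x,
      antipodeLin_gpow]
    simp
  | hy =>
    rw [comulHom_y, counitHom, lift_y, map_add, rightConv_tmul, rightConv_tmul, antipodeLin_y,
      antipodeLin_gpow]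
    simp
  | hmul u v hu hv =>
    rw [map_mul, rightConv_mul P _ hv, hu, map_mul, map_mul, Algebra.smul_def, Algebra.commutes]
  | hadd u v hu hv => rw [map_add, map_add, hu, hv, map_add, map_add]

/-- The Hopf algebra `H_q(a₁, a₂, b₁, b₂)`. -/
noncomputable instance instHopfAlgebra : HopfAlgebra k (TaftAlgebra P) where
  antipode := antipodeLin P
  mul_antipode_rTensor_comul := LinearMap.ext (leftConv_comul P)
  mul_antipode_lTensor_comul := LinearMap.ext (rightConv_comul P)

@[simp] theorem antipode_apply (u : TaftAlgebra P) :
    HopfAlgebra.antipode k u = antipodeLin P u := rfl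

/-- The group-like element `g ^ d`, for `d ∈ ℤ/N`. -/
noncomputable def groupLikePow (d : ZMod N) : GroupLike k (TaftAlgebra P) where
  val := gpow P d
  isGroupLikeElem_val := ⟨counitHom_gpow P d, comulHom_gpow P d⟩

theorem characterRelations (c : ZMod N) : Relations P (A := k) (P.qpow c) 0 0 where
  g_pow := by rw [TaftParams.qpow, ← pow_mul, mul_comm, pow_mul, P.primitive.pow_eq_one, one_pow]
  x_pow := zero_pow P.Nx_ne_zero
  y_pow := zero_pow P.Ny_ne_zero
  g_x := by simp
  g_y := by simp
  x_y := by simp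

/-- The character with `g ↦ q ^ c`, `x ↦ 0`, `y ↦ 0`, for `c ∈ ℤ/N`. In terms of the character `ξ`
with `ξ(g) = q⁻¹`, `ξ(x) = ξ(y) = 0`, it is the convolution power `ξ^{-c}`. -/
noncomputable def character (c : ZMod N) : TaftAlgebra P →ₐ[k] k := lift (characterRelations P c)

end TaftAlgebra

/-!
A character of `H = H_q(a₁, a₂, b₁, b₂)` kills the nilpotent elements `x` and `y` and sends `g` to
an `N`-th root of unity, so it is one of the `ξ ^ (-c)` (`TaftAlgebra.exists_eq_character`).

That every group-like `l` is a power of `g` (`TaftAlgebra.exists_eq_groupLikePow`) does not need a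
basis of `H`. For `t : k` the dilation `g ↦ g`, `x ↦ t x`, `y ↦ t y` is a bialgebra endomorphism,
so it sends `l` to a group-like element, and that element depends polynomially on `t`. Group-like
elements are linearly independent, hence only finitely many of them lie in the finite-dimensional
space spanned by the coefficients of this polynomial. As `k` is infinite, the polynomial is
constant (`Polynomial.eval_algebraMap_eq_of_linearIndepOn`), and comparing `t = 1` with `t = 0`
shows that `l` lies in the span of the powers of `g`. By linear independence again, `l` is one of
these powers.

For `l = g ^ d` and `β = ξ ^ (-c)`, both `S²` and `h ↦ β⁻¹(h₍₁₎) β(h₍₃₎) l h₍₂₎ l⁻¹` are algebra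
endomorphisms of `H`, so they agree as soon as they agree on `g`, `x` and `y`. Both fix `g`. The
first multiplies `x` by `q ^ (a₁ b₁)` and `y` by `q ^ (a₂ b₂)`, the second by `q ^ (a₁ c + b₁ d)`
and `q ^ (a₂ c + b₂ d)`. Since `x` and `y` are nonzero, as two-dimensional representations show
(`TaftAlgebra.x_ne_zero`, `TaftAlgebra.y_ne_zero`), agreement is the system of equations in `ℤ/N`
(`TaftAlgebra.isPairInInvolution_iff`). Finally `β(l) = q ^ (c d)`, which is `1` exactly when
`c d = 0`.
-/

/-! ### Powers of `q` with exponents in `ℤ/N` -/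

namespace TaftParams

variable {k : Type*} [Field k] {N : ℕ} (P : TaftParams k N)

theorem qpow_injective : Function.Injective P.qpow := by
  intro a b h
  have h1 : P.qpow (a - b) * P.qpow b = P.qpow b := by rw [← P.qpow_add, sub_add_cancel, h]
  have hb : P.qpow b ≠ 0 := fun h0 => by
    have := P.qpow_add b (-b)
    simp [h0, P.qpow_zero] at this
  exact sub_eq_zero.mp ((P.qpow_eq_one_iff _).mp ((mul_eq_right₀ hb).mp h1))

theorem qpow_pow_val (c d : ZMod N) : P.qpow c ^ d.val = P.qpow (c * d) := by
  have := P.neZero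
  rw [← P.qpow_nsmul, nsmul_eq_mul, ZMod.natCast_zmod_val, mul_comm]

theorem exists_qpow_eq {u : k} (hu : u ^ N = 1) : ∃ c, P.qpow c = u := by
  have := P.neZero
  obtain ⟨i, hi, rfl⟩ := P.primitive.eq_pow_of_pow_eq_one hu
  exact ⟨i, by rw [qpow, ZMod.val_cast_of_lt hi]⟩

theorem two_le_Nx : 2 ≤ P.Nx := by
  have h1 : P.Nx ≠ 1 := fun h => P.ne₁ (AddMonoid.addOrderOf_eq_one_iff.mp h)
  have := P.Nx_ne_zero
  omega

theorem two_le_Ny : 2 ≤ P.Ny := by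
  have h1 : P.Ny ≠ 1 := fun h => P.ne₂ (AddMonoid.addOrderOf_eq_one_iff.mp h)
  have := P.Ny_ne_zero
  omega

end TaftParams

namespace TaftAlgebra

variable {k : Type*} [Field k] {N : ℕ} (P : TaftParams k N)

/-! ### The skew-primitive generators do not vanish -/

theorem diagonal_one_qpow_pow (b : ZMod N) :
    (!![1, 0; 0, P.qpow b] : Matrix (Fin 2) (Fin 2) k) ^ N = 1 := by
  have h : (!![1, 0; 0, P.qpow b] : Matrix (Fin 2) (Fin 2) k)
      = Matrix.diagonal ![1, P.qpow b] := by
    ext i j; fin_cases i <;> fin_cases j <;> rfl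
  have hq : P.qpow b ^ N = 1 := (characterRelations P b).g_pow
  rw [h, Matrix.diagonal_pow, ← Matrix.diagonal_one]
  congr 1
  ext i; fin_cases i <;> simp [hq]

theorem single_pow_eq_zero {n : ℕ} (hn : 2 ≤ n) :
    (!![0, 0; 1, 0] : Matrix (Fin 2) (Fin 2) k) ^ n = 0 :=
  pow_eq_zero_of_le hn (by
    rw [pow_two]; ext i j; fin_cases i <;> fin_cases j <;> simp [Matrix.mul_apply])

theorem matrix_commutation (r : k) :
    (!![1, 0; 0, r] : Matrix (Fin 2) (Fin 2) k) * !![0, 0; 1, 0] =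
      r • (!![0, 0; 1, 0] * !![1, 0; 0, r]) := by
  ext i j; fin_cases i <;> fin_cases j <;> simp [Matrix.mul_apply]

/-- The two-dimensional representation with basis `e₀`, `e₁ = x e₀`, on which `y` acts as zero. -/
theorem xMatrixRelations : Relations P (A := Matrix (Fin 2) (Fin 2) k)
    !![1, 0; 0, P.qpow P.b₁] !![0, 0; 1, 0] 0 where
  g_pow := diagonal_one_qpow_pow P _
  x_pow := single_pow_eq_zero P.two_le_Nx
  y_pow := zero_pow P.Ny_ne_zero
  g_x := matrix_commutation _
  g_y := by simp
  x_y := by simp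

/-- The two-dimensional representation with basis `e₀`, `e₁ = y e₀`, on which `x` acts as zero. -/
theorem yMatrixRelations : Relations P (A := Matrix (Fin 2) (Fin 2) k)
    !![1, 0; 0, P.qpow P.b₂] 0 !![0, 0; 1, 0] where
  g_pow := diagonal_one_qpow_pow P _
  x_pow := zero_pow P.Nx_ne_zero
  y_pow := single_pow_eq_zero P.two_le_Ny
  g_x := by simp
  g_y := matrix_commutation _
  x_y := by simp

theorem x_ne_zero : x P ≠ 0 := by
  intro h
  have h1 := lift_x (xMatrixRelations P)
  rw [h, map_zero] at h1
  simpa using congrFun (congrFun h1 1) 0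

theorem y_ne_zero : y P ≠ 0 := by
  intro h
  have h1 := lift_y (yMatrixRelations P)
  rw [h, map_zero] at h1
  simpa using congrFun (congrFun h1 1) 0

/-! ### Characters -/

@[simp] theorem character_g (c : ZMod N) : character P c (g P) = P.qpow c := lift_g _

@[simp] theorem character_x (c : ZMod N) : character P c (x P) = 0 := lift_x _

@[simp] theorem character_y (c : ZMod N) : character P c (y P) = 0 := lift_y _

@[simp] theorem character_gpow (c d : ZMod N) : character P c (gpow P d) = P.qpow (c * d) := by
  rw [character, lift_gpow, P.qpow_pow_val]

theorem character_injective : Function.Injective (character P) := fun c c' h =>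
  P.qpow_injective (by rw [← character_g, h, character_g])

theorem gpow_injective : Function.Injective (gpow P) := fun d d' h =>
  P.qpow_injective (by simpa using congrArg (character P 1) h)

theorem exists_eq_character (β : TaftAlgebra P →ₐ[k] k) : ∃ c, β = character P c := by
  obtain ⟨c, hc⟩ := P.exists_qpow_eq (u := β (g P))
    (by rw [← map_pow, (relations P).g_pow, map_one])
  refine ⟨c, algHom_ext (by rw [character_g, hc]) ?_ ?_⟩
  · rw [character_x]
    exact eq_zero_of_pow_eq_zero (n := P.Nx) (by rw [← map_pow, (relations P).x_pow, map_zero])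
  · rw [character_y]
    exact eq_zero_of_pow_eq_zero (n := P.Ny) (by rw [← map_pow, (relations P).y_pow, map_zero])

/-! ### Dilations -/

theorem dilationRelations (t : k) : Relations P (g P) (t • x P) (t • y P) where
  g_pow := (relations P).g_pow
  x_pow := by rw [smul_pow, (relations P).x_pow, smul_zero]
  y_pow := by rw [smul_pow, (relations P).y_pow, smul_zero]
  g_x := by
    rw [mul_smul_comm, (relations P).g_x, smul_mul_assoc, smul_comm]
  g_y := by
    rw [mul_smul_comm, (relations P).g_y, smul_mul_assoc, smul_comm]
  x_y := by
    rw [smul_mul_smul_comm, (relations P).x_y, smul_mul_smul_comm, smul_comm]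

/-- The endomorphism `g ↦ g`, `x ↦ t x`, `y ↦ t y`, which is multiplication by `t ^ n` in degree
`n` when `g` has degree `0` and `x, y` have degree `1`. The value `t = 0` is allowed. -/
noncomputable def dilation (t : k) : TaftAlgebra P →ₐ[k] TaftAlgebra P :=
  lift (dilationRelations P t)

theorem comulHom_dilation (t : k) (u : TaftAlgebra P) :
    comulHom P (dilation P t u) =
      Algebra.TensorProduct.map (dilation P t) (dilation P t) (comulHom P u) := by
  refine DFunLike.congr_fun (f := (comulHom P).comp (dilation P t))
    (g := (Algebra.TensorProduct.map (dilation P t) (dilation P t)).comp (comulHom P))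
    (algHom_ext ?_ ?_ ?_) u <;>
  simp [comulHom, dilation, gpow, TensorProduct.smul_tmul']

theorem counitHom_dilation (t : k) (u : TaftAlgebra P) :
    counitHom P (dilation P t u) = counitHom P u := by
  refine DFunLike.congr_fun (f := (counitHom P).comp (dilation P t)) (g := counitHom P)
    (algHom_ext ?_ ?_ ?_) u <;>
  simp [counitHom, dilation]

theorem isGroupLikeElem_dilation (t : k) {u : TaftAlgebra P} (hu : IsGroupLikeElem k u) :
    IsGroupLikeElem k (dilation P t u) where
  counit_eq_one := (counitHom_dilation P t u).trans hu.counit_eq_one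
  comul_eq_tmul_self := by
    refine (comulHom_dilation P t u).trans ?_
    rw [show comulHom P u = u ⊗ₜ u from hu.comul_eq_tmul_self, Algebra.TensorProduct.map_tmul]

theorem dilation_one (u : TaftAlgebra P) : dilation P 1 u = u :=
  DFunLike.congr_fun (f := dilation P 1) (g := AlgHom.id k _)
    (algHom_ext (by simp [dilation]) (by simp [dilation]) (by simp [dilation])) u

/-- The dilation by `0` projects onto the span of the powers of `g`. -/
theorem dilation_zero_mem_span (u : TaftAlgebra P) :
    dilation P 0 u ∈ Submodule.span k (Set.range (gpow P)) := by
  induction u using gen_induction with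
  | hs r =>
    rw [AlgHom.commutes, Algebra.algebraMap_eq_smul_one, ← gpow_zero]
    exact Submodule.smul_mem _ _ (Submodule.subset_span ⟨0, rfl⟩)
  | hg => exact Submodule.subset_span ⟨1, by simp [dilation, gpow_one]⟩
  | hx => simp [dilation]
  | hy => simp [dilation]
  | hmul u v hu hv =>
    rw [map_mul]
    refine Submodule.span_induction₂ (p := fun a b _ _ => a * b ∈ _) ?_ ?_ ?_ ?_ ?_ ?_ ?_ hu hv
    · rintro _ _ ⟨a, rfl⟩ ⟨b, rfl⟩
      exact Submodule.subset_span ⟨a + b, gpow_add P a b⟩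
    · intros; simp
    · intros; simp
    · intro a b c _ _ _ ha hb; rw [add_mul]; exact add_mem ha hb
    · intro a b c _ _ _ ha hb; rw [mul_add]; exact add_mem ha hb
    · intro r a b _ _ h; rw [smul_mul_assoc]; exact Submodule.smul_mem _ _ h
    · intro r a b _ _ h; rw [mul_smul_comm]; exact Submodule.smul_mem _ _ h
  | hadd u v hu hv => rw [map_add]; exact add_mem hu hv

/-- The orbit map `t ↦ dilation t u` is polynomial in `t`. -/
theorem exists_dilation_eq_eval (u : TaftAlgebra P) :
    ∃ p : Polynomial (TaftAlgebra P), ∀ t : k, dilation P t u = p.eval (algebraMap k _ t) := by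
  induction u using gen_induction with
  | hs r => exact ⟨Polynomial.C (algebraMap k _ r), fun t => by simp⟩
  | hg => exact ⟨Polynomial.C (g P), fun t => by simp [dilation]⟩
  | hx =>
    exact ⟨Polynomial.C (x P) * Polynomial.X, fun t => by
      simp [dilation, Algebra.smul_def, Algebra.commutes]⟩
  | hy =>
    exact ⟨Polynomial.C (y P) * Polynomial.X, fun t => by
      simp [dilation, Algebra.smul_def, Algebra.commutes]⟩
  | hmul u v hu hv =>
    obtain ⟨p, hp⟩ := hu
    obtain ⟨r, hr⟩ := hv
    refine ⟨p * r, fun t => ?_⟩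
    rw [map_mul, hp, hr, Polynomial.eval, Polynomial.eval, Polynomial.eval,
      Polynomial.eval₂_mul_noncomm]
    exact fun n => (Algebra.commutes t _).symm
  | hadd u v hu hv =>
    obtain ⟨p, hp⟩ := hu
    obtain ⟨r, hr⟩ := hv
    exact ⟨p + r, fun t => by rw [map_add, hp, hr, Polynomial.eval_add]⟩

end TaftAlgebra

/-! ### Polynomials with linearly independent values -/

/-- A polynomial over a `k`-algebra whose values at the points of `k` lie in a linearly independent
set is constant on `k` when `k` is infinite: those values span a finite-dimensional space, so one
of them is attained infinitely often. -/
theorem Polynomial.eval_algebraMap_eq_of_linearIndepOn {k A : Type*} [Field k] [Infinite k] [Ring A]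
    [Algebra k A] (p : Polynomial A) {s : Set A} (hs : LinearIndepOn k id s)
    (hp : ∀ t : k, p.eval (algebraMap k A t) ∈ s) (t t' : k) :
    p.eval (algebraMap k A t) = p.eval (algebraMap k A t') := by
  have heval : ∀ t : k, p.eval (algebraMap k A t) =
      ∑ i ∈ Finset.range (p.natDegree + 1), t ^ i • p.coeff i := fun t => by
    rw [Polynomial.eval_eq_sum_range]
    refine Finset.sum_congr rfl fun i _ => ?_
    rw [← map_pow, ← Algebra.commutes, Algebra.smul_def]
  let W := Submodule.span k (p.coeff '' (Finset.range (p.natDegree + 1) : Set ℕ))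
  have : FiniteDimensional k W :=
    FiniteDimensional.span_of_finite k ((Finset.finite_toSet _).image _)
  have hW : ∀ t : k, p.eval (algebraMap k A t) ∈ W := fun t => by
    rw [heval]
    exact Submodule.sum_mem _ fun i hi =>
      Submodule.smul_mem _ _ (Submodule.subset_span ⟨i, hi, rfl⟩)
  have hfin : (s ∩ W).Finite := by
    have h1 : LinearIndependent k (fun v : ↥(s ∩ W) => (⟨v, v.2.2⟩ : W)) :=
      LinearIndependent.of_comp W.subtype (hs.mono Set.inter_subset_left)
    have := h1.finite
    exact Set.toFinite _
  have := hfin.to_subtype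
  obtain ⟨m, hm⟩ := Finite.exists_infinite_fiber
    (fun t : k => (⟨_, hp t, hW t⟩ : ↥(s ∩ (W : Set A))))
  have key : ∀ t : k, p.eval (algebraMap k A t) = m := fun t => by
    rw [← sub_eq_zero, ← Module.forall_dual_apply_eq_zero_iff k]
    intro f
    -- the image of `p - m` under `f`, a polynomial over `k` with infinitely many roots
    let r : Polynomial k := ∑ i ∈ Finset.range (p.natDegree + 1),
      Polynomial.C (f (p.coeff i)) * Polynomial.X ^ i - Polynomial.C (f m)
    have hr : ∀ t : k, r.eval t = f (p.eval (algebraMap k A t) - m) := fun t => by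
      rw [heval, map_sub, map_sum]
      simp only [r, Polynomial.eval_sub, Polynomial.eval_finsetSum, Polynomial.eval_mul,
        Polynomial.eval_C, Polynomial.eval_pow, Polynomial.eval_X, map_smul, smul_eq_mul, mul_comm]
    have h0 : r = 0 := Polynomial.eq_zero_of_infinite_isRoot r <|
      (Set.infinite_coe_iff.mp hm).mono fun t ht => by
        have := congrArg Subtype.val (show _ = m from ht)
        simp only at this
        simp [Polynomial.IsRoot, hr, this]
    rw [← hr, h0, Polynomial.eval_zero]
  rw [key, key]

namespace TaftAlgebra

variable {k : Type*} [Field k] {N : ℕ} (P : TaftParams k N)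

/-! ### Classification of the group-like elements -/

theorem exists_eq_groupLikePow [Infinite k] (l : GroupLike k (TaftAlgebra P)) :
    ∃ d, l = groupLikePow P d := by
  obtain ⟨p, hp⟩ := exists_dilation_eq_eval P (l : TaftAlgebra P)
  have hfix : dilation P 0 (l : TaftAlgebra P) = l := by
    rw [hp, p.eval_algebraMap_eq_of_linearIndepOn linearIndepOn_isGroupLikeElem
      (fun t => by rw [← hp]; exact isGroupLikeElem_dilation P t l.2) 0 1, ← hp, dilation_one]
  have hmem := dilation_zero_mem_span P (l : TaftAlgebra P)
  rw [hfix] at hmem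
  by_contra! hne
  refine linearIndep_groupLikeVal.notMem_span_image (s := Set.range (groupLikePow P)) (x := l)
    (fun ⟨d, hd⟩ => hne d hd.symm) ?_
  rwa [← Set.range_comp]

theorem groupLikePow_injective : Function.Injective (groupLikePow P) := fun _ _ h =>
  gpow_injective P (congrArg GroupLike.val h)

/-! ### Reduction of the involution condition to the generators -/

theorem characterInv_character (c : ZMod N) :
    characterInv (character P c) = (character P (-c)).toLinearMap := by
  ext u
  change character P c (antipodeLin P u) = character P (-c) u
  induction u using gen_induction with
  | hs r =>
    rw [AlgHom.commutes, Algebra.algebraMap_eq_smul_one, map_smul, antipodeLin_one, map_smul,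
      map_one, Algebra.algebraMap_eq_smul_one]
  | hg => rw [antipodeLin_g, character_gpow, character_g, mul_neg_one]
  | hx => simp [antipodeLin_x]
  | hy => simp [antipodeLin_y]
  | hmul u v hu hv => rw [antipodeLin_mul, map_mul, map_mul, hu, hv, mul_comm]
  | hadd u v hu hv => rw [map_add, map_add, map_add, hu, hv]

/-- The square of the antipode, as an algebra endomorphism. -/
noncomputable def antipodeSq : TaftAlgebra P →ₐ[k] TaftAlgebra P :=
  AlgHom.ofLinearMap (antipodeLin P ∘ₗ antipodeLin P) (by simp [antipodeLin_one])
    (fun u v => by simp [antipodeLin_mul])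

theorem groupLikeConj_groupLikePow (d : ZMod N) (u : TaftAlgebra P) :
    groupLikeConj (groupLikePow P d) u = gpow P d * (u * gpow P (-d)) := by
  rw [← antipodeLin_gpow]; rfl

/-- Conjugation by `g ^ d`, as an algebra endomorphism. -/
noncomputable def gpowConj (d : ZMod N) : TaftAlgebra P →ₐ[k] TaftAlgebra P :=
  AlgHom.ofLinearMap (groupLikeConj (groupLikePow P d))
    (by rw [groupLikeConj_groupLikePow, one_mul, gpow_mul_neg])
    (fun u v => by
      simp only [groupLikeConj_groupLikePow, mul_assoc]
      rw [← mul_assoc (gpow P (-d)) (gpow P d), gpow_neg_mul, one_mul])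

theorem gpowConj_apply (d : ZMod N) (u : TaftAlgebra P) :
    gpowConj P d u = gpow P d * (u * gpow P (-d)) :=
  groupLikeConj_groupLikePow P d u

/-- The map `h ↦ β⁻¹(h₍₁₎) β(h₍₃₎) l h₍₂₎ l⁻¹` for `l = g ^ d` and `β = ξ ^ (-c)`, as an algebra
endomorphism. -/
noncomputable def involutionHom (c d : ZMod N) : TaftAlgebra P →ₐ[k] TaftAlgebra P :=
  (Algebra.TensorProduct.lid k (TaftAlgebra P)).toAlgHom.comp <|
    (Algebra.TensorProduct.map (character P (-c))
      ((Algebra.TensorProduct.rid k k (TaftAlgebra P)).toAlgHom.comp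
        (Algebra.TensorProduct.map (gpowConj P d) (character P c)))).comp <|
    (Algebra.TensorProduct.map (AlgHom.id k _) (comulHom P)).comp (comulHom P)

theorem involutionMap_groupLikePow_character (c d : ZMod N) (u : TaftAlgebra P) :
    involutionMap (groupLikePow P d) (character P c) u = involutionHom P c d u := by
  rw [involutionMap, characterInv_character]
  rfl

theorem antipodeSq_apply (u : TaftAlgebra P) :
    antipodeSq P u = antipodeLin P (antipodeLin P u) := rfl

theorem antipodeSq_g : antipodeSq P (g P) = g P := by
  rw [antipodeSq_apply, antipodeLin_g, antipodeLin_gpow, neg_neg, gpow_one]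

theorem antipodeSq_x : antipodeSq P (x P) = P.qpow (P.a₁ * P.b₁) • x P := by
  rw [antipodeSq_apply, antipodeLin_x, map_neg, antipodeLin_mul, antipodeLin_gpow, antipodeLin_x,
    neg_neg, mul_neg, neg_neg, ← mul_assoc, gpow_x, smul_mul_assoc, mul_assoc, gpow_mul_neg,
    mul_one]

theorem antipodeSq_y : antipodeSq P (y P) = P.qpow (P.a₂ * P.b₂) • y P := by
  rw [antipodeSq_apply, antipodeLin_y, map_neg, antipodeLin_mul, antipodeLin_gpow, antipodeLin_y,
    neg_neg, mul_neg, neg_neg, ← mul_assoc, gpow_y, smul_mul_assoc, mul_assoc, gpow_mul_neg,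
    mul_one]

theorem gpowConj_x (d : ZMod N) : gpowConj P d (x P) = P.qpow (d * P.b₁) • x P := by
  rw [gpowConj_apply, ← mul_assoc, gpow_x, smul_mul_assoc, mul_assoc, gpow_mul_neg, mul_one]

theorem gpowConj_y (d : ZMod N) : gpowConj P d (y P) = P.qpow (d * P.b₂) • y P := by
  rw [gpowConj_apply, ← mul_assoc, gpow_y, smul_mul_assoc, mul_assoc, gpow_mul_neg, mul_one]

theorem involutionHom_g (c d : ZMod N) : involutionHom P c d (g P) = g P := by
  have hΔ : comulHom P (g P) = g P ⊗ₜ g P := by rw [← gpow_one, comulHom_gpow]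
  have hconj : gpowConj P d (g P) = g P := by
    rw [gpowConj_apply, ← gpow_one, ← gpow_add, ← gpow_add]
    congr 1
    ring
  have hq : P.qpow c * P.qpow (-c) = 1 := by rw [← P.qpow_add, add_neg_cancel, P.qpow_zero]
  simp [involutionHom, hΔ, hconj, smul_smul, hq]

theorem involutionHom_x (c d : ZMod N) :
    involutionHom P c d (x P) = P.qpow (P.a₁ * c + P.b₁ * d) • x P := by
  simp [involutionHom, comulHom_x, TensorProduct.tmul_add, gpowConj_x, smul_smul,
    ← P.qpow_add, mul_comm]

theorem involutionHom_y (c d : ZMod N) :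
    involutionHom P c d (y P) = P.qpow (P.a₂ * c + P.b₂ * d) • y P := by
  simp [involutionHom, comulHom_y, TensorProduct.tmul_add, gpowConj_y, smul_smul,
    ← P.qpow_add, mul_comm]

theorem isPairInInvolution_iff (c d : ZMod N) :
    IsPairInInvolution (groupLikePow P d) (character P c) ↔
      P.a₁ * c + P.b₁ * d = P.a₁ * P.b₁ ∧ P.a₂ * c + P.b₂ * d = P.a₂ * P.b₂ := by
  have hiff : IsPairInInvolution (groupLikePow P d) (character P c) ↔
      antipodeSq P = involutionHom P c d :=
    ⟨fun h => AlgHom.ext fun u => (h u).trans (involutionMap_groupLikePow_character P c d u),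
      fun h u => (DFunLike.congr_fun h u).trans
        (involutionMap_groupLikePow_character P c d u).symm⟩
  rw [hiff]
  constructor
  · intro h
    have hx := DFunLike.congr_fun h (x P)
    have hy := DFunLike.congr_fun h (y P)
    rw [antipodeSq_x, involutionHom_x] at hx
    rw [antipodeSq_y, involutionHom_y] at hy
    exact ⟨P.qpow_injective (smul_left_injective k (x_ne_zero P) hx.symm),
      P.qpow_injective (smul_left_injective k (y_ne_zero P) hy.symm)⟩
  · rintro ⟨h₁, h₂⟩
    apply algHom_ext
    · rw [antipodeSq_g, involutionHom_g]
    · rw [antipodeSq_x, involutionHom_x, h₁]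
    · rw [antipodeSq_y, involutionHom_y, h₂]

theorem isModularPairInInvolution_iff (c d : ZMod N) :
    IsModularPairInInvolution (groupLikePow P d) (character P c) ↔
      P.a₁ * c + P.b₁ * d = P.a₁ * P.b₁ ∧ P.a₂ * c + P.b₂ * d = P.a₂ * P.b₂ ∧ c * d = 0 := by
  rw [IsModularPairInInvolution, isPairInInvolution_iff, and_assoc,
    show ((groupLikePow P d : GroupLike k (TaftAlgebra P)) : TaftAlgebra P) = gpow P d from rfl,
    character_gpow, P.qpow_eq_one_iff]

end TaftAlgebra

/-! ### Pairs in involution of generalised Taft algebras -/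

theorem mainTheorem2 {k : Type*} [Field k] [IsAlgClosed k] [CharZero k] {N : ℕ}
    (P : TaftParams k N) :
    -- existence of a pair in involution, and of a modular one
    ((∃ (l : GroupLike k (TaftAlgebra P)) (β : TaftAlgebra P →ₐ[k] k), IsPairInInvolution l β) ↔
      ∃ c d : ZMod N, P.a₁ * c + P.b₁ * d = P.a₁ * P.b₁ ∧ P.a₂ * c + P.b₂ * d = P.a₂ * P.b₂) ∧
    ((∃ (l : GroupLike k (TaftAlgebra P)) (β : TaftAlgebra P →ₐ[k] k),
        IsModularPairInInvolution l β) ↔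
      ∃ c d : ZMod N, P.a₁ * c + P.b₁ * d = P.a₁ * P.b₁ ∧ P.a₂ * c + P.b₂ * d = P.a₂ * P.b₂ ∧
        c * d = 0) ∧
    -- every pair `(l, β)` belongs to exactly one `(c, d)`, through `l = g ^ d` and `β = ξ ^ (-c)`
    (∀ (l : GroupLike k (TaftAlgebra P)) (β : TaftAlgebra P →ₐ[k] k),
      ∃! p : ZMod N × ZMod N,
        l = TaftAlgebra.groupLikePow P p.2 ∧ β = TaftAlgebra.character P p.1) ∧
    -- the pair that belongs to `(c, d)` is in involution, respectively modular, as stated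
    (∀ c d : ZMod N,
      (IsPairInInvolution (TaftAlgebra.groupLikePow P d) (TaftAlgebra.character P c) ↔
        P.a₁ * c + P.b₁ * d = P.a₁ * P.b₁ ∧ P.a₂ * c + P.b₂ * d = P.a₂ * P.b₂) ∧
      (IsModularPairInInvolution (TaftAlgebra.groupLikePow P d) (TaftAlgebra.character P c) ↔
        P.a₁ * c + P.b₁ * d = P.a₁ * P.b₁ ∧ P.a₂ * c + P.b₂ * d = P.a₂ * P.b₂ ∧
          c * d = 0)) := by
  refine ⟨⟨?_, ?_⟩, ⟨?_, ?_⟩, ?_, fun c d => ⟨TaftAlgebra.isPairInInvolution_iff P c d,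
    TaftAlgebra.isModularPairInInvolution_iff P c d⟩⟩
  · rintro ⟨l, β, h⟩
    obtain ⟨d, rfl⟩ := TaftAlgebra.exists_eq_groupLikePow P l
    obtain ⟨c, rfl⟩ := TaftAlgebra.exists_eq_character P β
    exact ⟨c, d, (TaftAlgebra.isPairInInvolution_iff P c d).mp h⟩
  · rintro ⟨c, d, h⟩
    exact ⟨_, _, (TaftAlgebra.isPairInInvolution_iff P c d).mpr h⟩
  · rintro ⟨l, β, h⟩
    obtain ⟨d, rfl⟩ := TaftAlgebra.exists_eq_groupLikePow P l
    obtain ⟨c, rfl⟩ := TaftAlgebra.exists_eq_character P β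
    exact ⟨c, d, (TaftAlgebra.isModularPairInInvolution_iff P c d).mp h⟩
  · rintro ⟨c, d, h⟩
    exact ⟨_, _, (TaftAlgebra.isModularPairInInvolution_iff P c d).mpr h⟩
  · intro l β
    obtain ⟨d, rfl⟩ := TaftAlgebra.exists_eq_groupLikePow P l
    obtain ⟨c, rfl⟩ := TaftAlgebra.exists_eq_character P β
    refine ⟨(c, d), ⟨rfl, rfl⟩, ?_⟩
    rintro ⟨c', d'⟩ ⟨hd, hc⟩
    exact Prod.ext (TaftAlgebra.character_injective P hc).symm
      (TaftAlgebra.groupLikePow_injective P hd).symm
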